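/- Fix a dimension $K$, a constant $C>0$ and a link function $f:\mathbb R\to\mathbb R$. For all $N,J$ let $\theta_i^*\in\mathbb R^K$ ($1\le i\le N$) be true person parameters and $a_j^*\in\mathbb R^K$, $d_j^*\in\mathbb R$ ($1\le j\le J$) true item parameters (all deterministic and allowed to depend on $N,J$), and let $Y_{ij}\in\{0,1\}$, $1\le i\le N$, $1\le j\le J$, be independent random variables with $$P(Y_{ij}=1)=f\big(d_j^*+(a_j^*)^\top\theta_i^*\big).$$ Let $(\hat\theta_i,\hat a_j,\hat d_j)$ be a constrained joint maximum likelihood estimate, i.e. any (not necessarily unique) maximizer of the log-likelihood $$\log\prod_{i=1}^N\prod_{j=1}^J f(d_j+a_j^\top\theta_i)^{Y_{ij}}\big(1-f(d_j+a_j^\top\theta_i)\big)^{1-Y_{ij}}$$ subject to $\sqrt{1+\|\theta_i\|^2}\le C$ and $\sqrt{d_j^2+\|a_j\|^2}\le C$ for all $i,j$, where $\|\cdot\|$ is the Euclidean norm. Assume: (A1) for all $N,J$: $\sqrt{1+\|\theta_i^*\|^2}\le C$ and $\sqrt{(d_j^*)^2+\|a_j^*\|^2}\le C$ for $i=1,\dots,N$,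 $j=1,\dots,J$; (A2) $f$ is differentiable, $0<f(x)<1$ and $f'(x)\ne0$ for $|x|\le C^2$, and $$\sup_{|x|\le C^2}\frac{|f'(x)|}{f(x)(1-f(x))}<\infty,\qquad \sup_{|x|\le C^2}\frac{f(x)(1-f(x))}{(f'(x))^2}<\infty.$$ Then, as $N$ and $J$ both tend to infinity (at arbitrary relative rates), $$\frac1{NJ}\sum_{i=1}^N\sum_{j=1}^J\Big(f(\hat d_j+\hat a_j^\top\hat\theta_i)-f\big(d_j^*+(a_j^*)^\top\theta_i^*\big)\Big)^2\longrightarrow 0\quad\text{in probability.}$$ -/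

import Mathlib

open MeasureTheory ProbabilityTheory Filter Topology

namespace IFA

/-- Parameters of an item factor analysis model with `N` respondents, `J` items and `K` latent
factors: person parameters `θ i`, loadings `a j` and intercepts `d j`. -/
structure Params (N J K : ℕ) where
  θ : Fin N → EuclideanSpace ℝ (Fin K)
  a : Fin J → EuclideanSpace ℝ (Fin K)
  d : Fin J → ℝ

/-- The linear predictor `d_j + a_jᵀ θ_i`. -/
noncomputable def Params.pred {N J K : ℕ} (p : Params N J K) (i : Fin N) (j : Fin J) : ℝ :=
  p.d j + inner ℝ (p.a j) (p.θ i)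

/-- The constraint set `√(1 + ‖θ_i‖²) ≤ C`, `√(d_j² + ‖a_j‖²) ≤ C` for all `i`, `j`. -/
def feasible (N J K : ℕ) (C : ℝ) : Set (Params N J K) :=
  {p | (∀ i, √(1 + ‖p.θ i‖ ^ 2) ≤ C) ∧ ∀ j, √(p.d j ^ 2 + ‖p.a j‖ ^ 2) ≤ C}

/-- The joint likelihood `∏_{i,j} f(d_j + a_jᵀθ_i)^{y_ij} (1 - f(d_j + a_jᵀθ_i))^{1 - y_ij}` of
the dichotomous responses `y_ij ∈ {0, 1}`. -/
noncomputable def likelihood {N J K : ℕ} (f : ℝ → ℝ) (y : Fin N → Fin J → Fin 2)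
    (p : Params N J K) : ℝ :=
  ∏ i, ∏ j, f (p.pred i j) ^ (y i j : ℕ) * (1 - f (p.pred i j)) ^ (1 - (y i j : ℕ))

/-- `p` is a constrained joint maximum likelihood estimate for the data `y`: it is a (not
necessarily unique) maximizer of the joint log-likelihood over the constraint set. -/
def IsCJMLE {N J K : ℕ} (f : ℝ → ℝ) (C : ℝ) (y : Fin N → Fin J → Fin 2)
    (p : Params N J K) : Prop :=
  p ∈ feasible N J K C ∧ IsMaxOn (fun q => Real.log (likelihood f y q)) (feasible N J K C) p

/-- The regularity condition on the link function: `f` is differentiable, and on `|x| ≤ C²` it is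
probability-valued, both ratios `|f'| / (f (1 - f))` and `f (1 - f) / (f')²` are defined
(their denominators do not vanish), and both have a finite supremum. -/
structure RegularLink (f : ℝ → ℝ) (C : ℝ) : Prop where
  differentiable : Differentiable ℝ f
  mem_Ioo : ∀ x, |x| ≤ C ^ 2 → f x ∈ Set.Ioo (0 : ℝ) 1
  deriv_ne_zero : ∀ x, |x| ≤ C ^ 2 → deriv f x ≠ 0
  bdd_left : BddAbove ((fun x => |deriv f x| / (f x * (1 - f x))) '' {x | |x| ≤ C ^ 2})
  bdd_right : BddAbove ((fun x => f x * (1 - f x) / deriv f x ^ 2) '' {x | |x| ≤ C ^ 2})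

/-- The response matrix `Y` follows the item factor model with link `f` and true parameters `p`:
its entries are independent with `P(Y_ij = 1) = f(d_j + a_jᵀ θ_i)`. -/
structure IsModel {N J K : ℕ} {Ω : Type*} [MeasurableSpace Ω] (μ : Measure Ω) (f : ℝ → ℝ)
    (p : Params N J K) (Y : Fin N → Fin J → Ω → Fin 2) : Prop where
  measurable : ∀ i j, Measurable (Y i j)
  prob : ∀ i j, μ.real {ω | Y i j ω = 1} = f (p.pred i j)
  indep : iIndepFun (fun (ij : Fin N × Fin J) => Y ij.1 ij.2) μ

/-- The average squared difference between the response probabilities under `p` and `q`. -/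
noncomputable def avgSqDiff {N J K : ℕ} (f : ℝ → ℝ) (p q : Params N J K) : ℝ :=
  (∑ i, ∑ j, (f (p.pred i j) - f (q.pred i j)) ^ 2) / ((N : ℝ) * (J : ℝ))

end IFA

/-!
Let `π` and `ρ` be the matrices of response probabilities under the truth and under the estimate.
Splitting the log-likelihood ratio into a noise term linear in `Y - π` and minus a Kullback–Leibler
divergence, and bounding the latter below by the squared Hellinger distance, gives the basic
inequality `∑ (ρ - π)² ≤ ∑ (Y - π) (logit ρ - logit π)` whenever the estimate is at least as likely
as the truth. Up to a uniform error `η`, the log-odds matrix `logit ρ` is one of at most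
`m ^ N * n ^ J` matrices, because persons and items can be rounded separately in their compact
parameter sets. By Hoeffding's inequality, for each of these matrices the noise sum is of order
`N J` with probability at most `exp (-c N J)`, and `N J` beats the entropy `N log m + J log n` when
both `N` and `J` tend to infinity.
-/

namespace IFA

section Bernoulli

/-- The log-likelihood `y log p + (1 - y) log (1 - p)` of success probability `p` at outcome `y`.
Taking `y` real makes `bernoulliLogLik p q` the negative cross entropy of two Bernoulli laws. -/
noncomputable def bernoulliLogLik (y p : ℝ) : ℝ := y * Real.log p + (1 - y) * Real.log (1 - p)

/-- The log-odds of a probability `p`, the natural parameter of the Bernoulli family. -/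
noncomputable def logit (p : ℝ) : ℝ := Real.log p - Real.log (1 - p)

lemma continuousOn_logit : ContinuousOn logit (Set.Ioo 0 1) :=
  (continuousOn_id.log fun _ hp => hp.1.ne').sub
    ((continuousOn_const.sub continuousOn_id).log fun _ hp => (sub_pos.2 hp.2).ne')

lemma mul_log_sub_log_le_sqrt {x y : ℝ} (hx : 0 < x) (hy : 0 < y) :
    x * (Real.log y - Real.log x) ≤ 2 * (√x * √y - x) := by
  have hsx := Real.sqrt_pos.2 hx
  have hsy := Real.sqrt_pos.2 hy
  have hlog : (Real.log y - Real.log x) / 2 ≤ √y / √x - 1 := by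
    have h := Real.log_le_sub_one_of_pos (div_pos hsy hsx)
    rw [Real.log_div hsy.ne' hsx.ne', Real.log_sqrt hx.le, Real.log_sqrt hy.le] at h
    linarith
  calc x * (Real.log y - Real.log x) = 2 * (x * ((Real.log y - Real.log x) / 2)) := by ring
    _ ≤ 2 * (x * (√y / √x - 1)) := by gcongr
    _ = 2 * (√x * √y - x) := by rw [mul_sub, mul_div_left_comm, Real.div_sqrt]; ring

-- With `(a, a') = (cos α, sin α)` and `(b, b') = (cos β, sin β)` this reads
-- `sin² (α - β) sin² (α + β) ≤ 2 - 2 cos (α - β)`.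
lemma sq_sub_sq_sq_le_of_sq_add_sq_eq_one {a a' b b' : ℝ} (ha : a ^ 2 + a' ^ 2 = 1)
    (hb : b ^ 2 + b' ^ 2 = 1) : (b ^ 2 - a ^ 2) ^ 2 ≤ (a - b) ^ 2 + (a' - b') ^ 2 := by
  have hfactor : b ^ 2 - a ^ 2 = (a' * b - a * b') * (a' * b + a * b') := by
    linear_combination -b ^ 2 * ha + a ^ 2 * hb
  have hsin_add : (a' * b + a * b') ^ 2 = 1 - (a * b - a' * b') ^ 2 := by
    linear_combination (b ^ 2 + b' ^ 2) * ha + hb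
  have hsin_sub : (a' * b - a * b') ^ 2 = 1 - (a * b + a' * b') ^ 2 := by
    linear_combination (b ^ 2 + b' ^ 2) * ha + hb
  calc (b ^ 2 - a ^ 2) ^ 2 = (a' * b - a * b') ^ 2 * (a' * b + a * b') ^ 2 := by
        rw [hfactor, mul_pow]
    _ ≤ (a' * b - a * b') ^ 2 :=
        mul_le_of_le_one_right (sq_nonneg _) (hsin_add.trans_le (sub_le_self _ (sq_nonneg _)))
    _ ≤ (a - b) ^ 2 + (a' - b') ^ 2 := by
        rw [hsin_sub]
        linarith [sq_nonneg (a * b + a' * b' - 1)]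

lemma bernoulliLogLik_le_self_sub_sq {p q : ℝ} (hp : p ∈ Set.Ioo (0 : ℝ) 1)
    (hq : q ∈ Set.Ioo (0 : ℝ) 1) :
    bernoulliLogLik p q ≤ bernoulliLogLik p p - (q - p) ^ 2 := by
  have hp' : 0 < 1 - p := sub_pos.2 hp.2
  have hq' : 0 < 1 - q := sub_pos.2 hq.2
  have hsuccess := mul_log_sub_log_le_sqrt hp.1 hq.1
  have hfailure := mul_log_sub_log_le_sqrt hp' hq'
  have hhellinger : (q - p) ^ 2 ≤ (√p - √q) ^ 2 + (√(1 - p) - √(1 - q)) ^ 2 := by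
    have h := sq_sub_sq_sq_le_of_sq_add_sq_eq_one (a := √p) (a' := √(1 - p)) (b := √q)
      (b' := √(1 - q)) (by rw [Real.sq_sqrt hp.1.le, Real.sq_sqrt hp'.le]; ring)
      (by rw [Real.sq_sqrt hq.1.le, Real.sq_sqrt hq'.le]; ring)
    rwa [Real.sq_sqrt hp.1.le, Real.sq_sqrt hq.1.le] at h
  rw [sub_sq √p, sub_sq √(1 - p), Real.sq_sqrt hp.1.le, Real.sq_sqrt hq.1.le, Real.sq_sqrt hp'.le,
    Real.sq_sqrt hq'.le] at hhellinger
  simp only [bernoulliLogLik]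
  linarith

lemma bernoulliLogLik_sub_le (y : ℝ) {p q : ℝ} (hp : p ∈ Set.Ioo (0 : ℝ) 1)
    (hq : q ∈ Set.Ioo (0 : ℝ) 1) :
    bernoulliLogLik y q - bernoulliLogLik y p ≤
      (y - p) * (logit q - logit p) - (q - p) ^ 2 := by
  have h := bernoulliLogLik_le_self_sub_sq hp hq
  simp only [bernoulliLogLik, logit] at h ⊢
  linarith

end Bernoulli

section Hoeffding

variable {Ω : Type*} [MeasurableSpace Ω] {μ : Measure Ω}

lemma hasSubgaussianMGF_mono {X : Ω → ℝ} {c d : NNReal} (h : HasSubgaussianMGF X c μ)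
    (hcd : c ≤ d) : HasSubgaussianMGF X d μ where
  integrable_exp_mul := h.integrable_exp_mul
  mgf_le t := (h.mgf_le t).trans (by gcongr)

variable {ι : Type*} [Fintype ι] {X : ι → Ω → ℝ} {V t : ℝ}

lemma measureReal_sum_sub_integral_mul_ge_le (hX : iIndepFun X μ)
    (hm : ∀ i, AEMeasurable (X i) μ) (hX01 : ∀ i, ∀ᵐ ω ∂μ, X i ω ∈ Set.Icc (0 : ℝ) 1)
    {w : ι → ℝ} (hw : ∑ i, w i ^ 2 ≤ V) (ht : 0 ≤ t) :
    μ.real {ω | t ≤ ∑ i, (X i ω - μ[X i]) * w i} ≤ Real.exp (-(2 * t ^ 2 / V)) := by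
  have := hX.isProbabilityMeasure
  have hV : 0 ≤ V := (Finset.sum_nonneg fun i _ => sq_nonneg (w i)).trans hw
  have hterm : ∀ i, HasSubgaussianMGF (fun ω => (X i ω - μ[X i]) * w i) ((‖w i‖₊ / 2) ^ 2) μ :=
    fun i => by
      convert (hasSubgaussianMGF_of_mem_Icc (hm i) (hX01 i)).const_mul (w i) using 1
      · simp only [mul_comm]
      · ext
        change (|w i| / 2) ^ 2 = w i ^ 2 * (‖(1 : ℝ) - 0‖ / 2) ^ 2
        rw [div_pow, sq_abs, sub_zero, norm_one]
        ring
  have hind : iIndepFun (fun i ω => (X i ω - μ[X i]) * w i) μ :=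
    hX.comp (fun i x => (x - ∫ ω, X i ω ∂μ) * w i) fun i => (measurable_id.sub_const _).mul_const _
  have hsum : HasSubgaussianMGF (fun ω => ∑ i, (X i ω - μ[X i]) * w i) (V / 4).toNNReal μ := by
    refine hasSubgaussianMGF_mono
      (HasSubgaussianMGF.sum_of_iIndepFun hind (s := Finset.univ) fun i _ => hterm i) ?_
    rw [Real.le_toNNReal_iff_coe_le (by positivity)]
    push_cast
    simp only [Real.norm_eq_abs, div_pow, sq_abs, ← Finset.sum_div]
    linarith
  refine (hsum.measure_ge_le ht).trans_eq ?_
  rw [Real.coe_toNNReal _ (by positivity)]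
  congr 1
  ring

lemma measureReal_exists_sum_sub_integral_mul_ge_le (hX : iIndepFun X μ)
    (hm : ∀ i, AEMeasurable (X i) μ) (hX01 : ∀ i, ∀ᵐ ω ∂μ, X i ω ∈ Set.Icc (0 : ℝ) 1)
    {G : Type*} [Fintype G] {w : G → ι → ℝ} (hw : ∀ g, ∑ i, w g i ^ 2 ≤ V) (ht : 0 ≤ t) :
    μ.real {ω | ∃ g, t ≤ ∑ i, (X i ω - μ[X i]) * w g i} ≤
      Fintype.card G * Real.exp (-(2 * t ^ 2 / V)) := by
  calc μ.real {ω | ∃ g, t ≤ ∑ i, (X i ω - μ[X i]) * w g i}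
      ≤ ∑ g, μ.real {ω | t ≤ ∑ i, (X i ω - μ[X i]) * w g i} := by
        rw [Set.ofPred_exists]
        exact measureReal_iUnion_fintype_le _
    _ ≤ ∑ _g : G, Real.exp (-(2 * t ^ 2 / V)) :=
        Finset.sum_le_sum fun g _ => measureReal_sum_sub_integral_mul_ge_le hX hm hX01 (hw g) ht
    _ = Fintype.card G * Real.exp (-(2 * t ^ 2 / V)) := by simp

end Hoeffding

section Net

lemma exists_fin_net {X : Type*} [PseudoMetricSpace X] {A : Set X} (hA : TotallyBounded A) {δ : ℝ}
    (hδ : 0 < δ) : ∃ (m : ℕ) (a : Fin m → A) (r : A → Fin m), ∀ x : A, dist x (a (r x)) < δ := by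
  obtain ⟨S, hSA, hSf, hS⟩ := Metric.finite_approx_of_totallyBounded hA δ hδ
  have := hSf.to_subtype
  have hnear : ∀ x : A, ∃ z : S, dist (x : X) z < δ := fun x => by
    obtain ⟨z, hz, hxz⟩ := Set.mem_iUnion₂.1 (hS x.2)
    exact ⟨⟨z, hz⟩, hxz⟩
  choose r hr using hnear
  refine ⟨Nat.card S, Set.inclusion hSA ∘ (Finite.equivFin S).symm, Finite.equivFin S ∘ r,
    fun x => ?_⟩
  rw [Function.comp_apply, Function.comp_apply, Equiv.symm_apply_apply]
  exact hr x

lemma exists_fin_net_prod {X Y Z : Type*} [PseudoMetricSpace X] [PseudoMetricSpace Y]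
    [PseudoMetricSpace Z] {A : Set X} {B : Set Y} (hA : TotallyBounded A) (hB : TotallyBounded B)
    {F : X × Y → Z} (hF : UniformContinuousOn F (A ×ˢ B)) {η : ℝ} (hη : 0 < η) :
    ∃ (m n : ℕ) (a : Fin m → A) (b : Fin n → B) (r : A → Fin m) (s : B → Fin n),
      ∀ (x : A) (y : B), dist (F (x, y)) (F (a (r x), b (s y))) < η := by
  obtain ⟨δ, hδ, hFδ⟩ := Metric.uniformContinuousOn_iff.1 hF η hη
  obtain ⟨m, a, r, hr⟩ := exists_fin_net hA hδ
  obtain ⟨n, b, s, hs⟩ := exists_fin_net hB hδ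
  exact ⟨m, n, a, b, r, s, fun x y => hFδ _ ⟨x.2, y.2⟩ _ ⟨(a _).2, (b _).2⟩ (max_lt (hr x) (hs y))⟩

end Net

section ParameterSpace

/-- The person parameters `θ` allowed by the constraint `√(1 + ‖θ‖²) ≤ C`. -/
def personSet (E : Type*) [NormedAddCommGroup E] (C : ℝ) : Set E := {θ | √(1 + ‖θ‖ ^ 2) ≤ C}

/-- The item parameters allowed by the constraint `√(d² + ‖a‖²) ≤ C`, encoded as pairs `(d, a)` of
an intercept and a loading. -/
def itemSet (E : Type*) [NormedAddCommGroup E] (C : ℝ) : Set (ℝ × E) :=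
  {v | √(v.1 ^ 2 + ‖v.2‖ ^ 2) ≤ C}

variable {E : Type*} [NormedAddCommGroup E]

lemma isCompact_personSet [ProperSpace E] (C : ℝ) : IsCompact (personSet E C) := by
  refine (isCompact_closedBall (0 : E) C).of_isClosed_subset
    (isClosed_le (by fun_prop) continuous_const) fun θ hθ => ?_
  rw [mem_closedBall_zero_iff]
  exact (Real.le_sqrt_of_sq_le (by linarith)).trans hθ

lemma isCompact_itemSet [ProperSpace E] (C : ℝ) : IsCompact (itemSet E C) := by
  refine (isCompact_closedBall (0 : ℝ × E) C).of_isClosed_subset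
    (isClosed_le (by fun_prop) continuous_const) fun v hv => ?_
  rw [mem_closedBall_zero_iff, Prod.norm_def]
  refine max_le ((Real.le_sqrt_of_sq_le ?_).trans hv) ((Real.le_sqrt_of_sq_le ?_).trans hv)
  · rw [Real.norm_eq_abs, sq_abs]
    exact le_add_of_nonneg_right (sq_nonneg _)
  · exact le_add_of_nonneg_left (sq_nonneg _)

lemma abs_add_inner_le_sqrt_mul_sqrt [InnerProductSpace ℝ E] (d : ℝ) (a θ : E) :
    |d + inner ℝ a θ| ≤ √(d ^ 2 + ‖a‖ ^ 2) * √(1 + ‖θ‖ ^ 2) := by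
  rw [← Real.sqrt_mul (by positivity)]
  refine Real.le_sqrt_of_sq_le ?_
  calc |d + inner ℝ a θ| ^ 2 ≤ (|d| + ‖a‖ * ‖θ‖) ^ 2 := by
        gcongr
        exact (abs_add_le _ _).trans (by gcongr; exact abs_real_inner_le_norm a θ)
    _ ≤ (d ^ 2 + ‖a‖ ^ 2) * (1 + ‖θ‖ ^ 2) := by
        linarith [sq_nonneg (|d| * ‖θ‖ - ‖a‖), sq_abs d,
          congrArg (· * ‖θ‖ ^ 2) (sq_abs d)]

lemma add_inner_mem_Icc [InnerProductSpace ℝ E] {C : ℝ} {θ : E} {v : ℝ × E}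
    (hθ : θ ∈ personSet E C) (hv : v ∈ itemSet E C) :
    v.1 + inner ℝ v.2 θ ∈ Set.Icc (-C ^ 2) (C ^ 2) := by
  rw [Set.mem_Icc, ← abs_le, sq]
  exact (abs_add_inner_le_sqrt_mul_sqrt _ _ _).trans
    (mul_le_mul hv hθ (Real.sqrt_nonneg _) ((Real.sqrt_nonneg _).trans hv))

lemma pred_mem_Icc {N J K : ℕ} {C : ℝ} {p : Params N J K} (hp : p ∈ feasible N J K C) (i : Fin N)
    (j : Fin J) : p.pred i j ∈ Set.Icc (-C ^ 2) (C ^ 2) :=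
  add_inner_mem_Icc (v := (p.d j, p.a j)) (hp.1 i) (hp.2 j)

lemma exists_net_feasible (K : ℕ) {C : ℝ} {h : ℝ → ℝ}
    (hh : ContinuousOn h (Set.Icc (-C ^ 2) (C ^ 2))) {η : ℝ} (hη : 0 < η) :
    ∃ m n : ℕ, ∀ N J : ℕ, ∃ g : (Fin N → Fin m) × (Fin J → Fin n) → Params N J K,
      (∀ k, g k ∈ feasible N J K C) ∧ ∀ q ∈ feasible N J K C, ∃ k, ∀ i j,
        |h (q.pred i j) - h ((g k).pred i j)| < η := by
  let E := EuclideanSpace ℝ (Fin K)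
  have hcont : ContinuousOn (fun z : E × (ℝ × E) => h (z.2.1 + inner ℝ z.2.2 z.1))
      (personSet E C ×ˢ itemSet E C) :=
    hh.comp (Continuous.continuousOn (by fun_prop)) fun z hz => add_inner_mem_Icc hz.1 hz.2
  have hP := isCompact_personSet (E := E) C
  have hI := isCompact_itemSet (E := E) C
  obtain ⟨m, n, a, b, r, s, hrs⟩ := exists_fin_net_prod hP.totallyBounded hI.totallyBounded
    ((hP.prod hI).uniformContinuousOn_of_continuous hcont) hη
  refine ⟨m, n, fun N J => ⟨fun k =>
      ⟨fun i => a (k.1 i), fun j => (b (k.2 j)).1.2, fun j => (b (k.2 j)).1.1⟩,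
    fun k => ⟨fun i => (a (k.1 i)).2, fun j => (b (k.2 j)).2⟩, fun q hq => ?_⟩⟩
  exact ⟨(fun i => r ⟨q.θ i, hq.1 i⟩, fun j => s ⟨(q.d j, q.a j), hq.2 j⟩),
    fun i j => hrs ⟨q.θ i, hq.1 i⟩ ⟨(q.d j, q.a j), hq.2 j⟩⟩

end ParameterSpace

section BasicInequality

variable {N J K : ℕ} {f : ℝ → ℝ} {y : Fin N → Fin J → Fin 2} {p q : Params N J K}

lemma natCast_fin_two_mem_Icc (k : Fin 2) : ((k : ℕ) : ℝ) ∈ Set.Icc (0 : ℝ) 1 :=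
  ⟨Nat.cast_nonneg _, by exact_mod_cast Nat.le_of_lt_succ k.isLt⟩

lemma log_likelihood (y : Fin N → Fin J → Fin 2) (hp : ∀ i j, f (p.pred i j) ∈ Set.Ioo (0 : ℝ) 1) :
    Real.log (likelihood f y p) = ∑ i, ∑ j, bernoulliLogLik (y i j : ℕ) (f (p.pred i j)) := by
  have hpow : ∀ i j, f (p.pred i j) ^ (y i j : ℕ) ≠ 0 := fun i j => pow_ne_zero _ (hp i j).1.ne'
  have hpow' : ∀ i j, (1 - f (p.pred i j)) ^ (1 - (y i j : ℕ)) ≠ 0 := fun i j =>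
    pow_ne_zero _ (sub_pos.2 (hp i j).2).ne'
  rw [likelihood, Real.log_prod fun i _ =>
    Finset.prod_ne_zero_iff.2 fun j _ => mul_ne_zero (hpow i j) (hpow' i j)]
  refine Finset.sum_congr rfl fun i _ => ?_
  rw [Real.log_prod fun j _ => mul_ne_zero (hpow i j) (hpow' i j)]
  refine Finset.sum_congr rfl fun j _ => ?_
  rw [Real.log_mul (hpow i j) (hpow' i j), Real.log_pow, Real.log_pow, Nat.cast_sub (by omega),
    Nat.cast_one, bernoulliLogLik]

lemma sum_sq_le_of_log_likelihood_le (hp : ∀ i j, f (p.pred i j) ∈ Set.Ioo (0 : ℝ) 1)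
    (hq : ∀ i j, f (q.pred i j) ∈ Set.Ioo (0 : ℝ) 1)
    (hpq : Real.log (likelihood f y p) ≤ Real.log (likelihood f y q)) :
    ∑ i, ∑ j, (f (q.pred i j) - f (p.pred i j)) ^ 2 ≤
      ∑ i, ∑ j, ((y i j : ℕ) - f (p.pred i j)) *
        (logit (f (q.pred i j)) - logit (f (p.pred i j))) := by
  rw [log_likelihood y hp, log_likelihood y hq] at hpq
  have hsum := Finset.sum_le_sum fun i (_ : i ∈ Finset.univ) =>
    Finset.sum_le_sum fun j (_ : j ∈ Finset.univ) =>
      bernoulliLogLik_sub_le (y i j : ℕ) (hp i j) (hq i j)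
  simp only [Finset.sum_sub_distrib] at hsum
  linarith

lemma le_sum_noise_mul_of_le_avgSqDiff (hp : ∀ i j, f (p.pred i j) ∈ Set.Ioo (0 : ℝ) 1)
    (hq : ∀ i j, f (q.pred i j) ∈ Set.Ioo (0 : ℝ) 1)
    (hpq : Real.log (likelihood f y p) ≤ Real.log (likelihood f y q)) {g : Fin N → Fin J → ℝ}
    {η : ℝ} (hg : ∀ i j, |logit (f (q.pred i j)) - g i j| ≤ η) {ε : ℝ}
    (hε : ε ≤ avgSqDiff f q p) :
    (ε - η) * (N * J) ≤
      ∑ i, ∑ j, ((y i j : ℕ) - f (p.pred i j)) * (g i j - logit (f (p.pred i j))) := by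
  have hloss : ε * (N * J) ≤ ∑ i, ∑ j, (f (q.pred i j) - f (p.pred i j)) ^ 2 :=
    mul_le_of_le_div₀ (by positivity) (by positivity) hε
  have hterm : ∀ i j, ((y i j : ℕ) - f (p.pred i j)) *
      (logit (f (q.pred i j)) - logit (f (p.pred i j))) ≤
      ((y i j : ℕ) - f (p.pred i j)) * (g i j - logit (f (p.pred i j))) + η := fun i j => by
    have hy := natCast_fin_two_mem_Icc (y i j)
    have hnoise : |((y i j : ℕ) : ℝ) - f (p.pred i j)| ≤ 1 :=
      abs_le.2 ⟨by linarith [hy.1, (hp i j).2], by linarith [hy.2, (hp i j).1]⟩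
    have hround : ((y i j : ℕ) - f (p.pred i j)) * (logit (f (q.pred i j)) - g i j) ≤ η :=
      (le_abs_self _).trans ((abs_mul _ _).trans_le
        ((mul_le_of_le_one_left (abs_nonneg _) hnoise).trans (hg i j)))
    linarith
  have hsum := (sum_sq_le_of_log_likelihood_le hp hq hpq).trans
    (Finset.sum_le_sum fun i _ => Finset.sum_le_sum fun j _ => hterm i j)
  simp only [Finset.sum_add_distrib, Finset.sum_const, Finset.card_univ, Fintype.card_fin,
    nsmul_eq_mul] at hsum
  linarith

end BasicInequality

section Consistency

variable {f : ℝ → ℝ}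

lemma integral_natCast_fin_two {Ω : Type*} [MeasurableSpace Ω] {μ : Measure Ω} {Z : Ω → Fin 2}
    (hZ : Measurable Z) : ∫ ω, ((Z ω : ℕ) : ℝ) ∂μ = μ.real {ω | Z ω = 1} := by
  have hindicator : (fun ω => ((Z ω : ℕ) : ℝ)) = {ω | Z ω = 1}.indicator 1 := by
    ext ω
    obtain h | h : Z ω = 0 ∨ Z ω = 1 := by omega
    all_goals simp [h]
  rw [hindicator]
  exact integral_indicator_one (hZ (measurableSet_singleton 1))

lemma IsModel.measureReal_exists_noise_ge_le {N J K : ℕ} {Ω : Type*} [MeasurableSpace Ω]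
    {μ : Measure Ω} {p : Params N J K} {Y : Fin N → Fin J → Ω → Fin 2} (hY : IsModel μ f p Y)
    {G : Type*} [Fintype G] {w : G → Fin N → Fin J → ℝ} {B : ℝ} (hw : ∀ g i j, |w g i j| ≤ B)
    {η : ℝ} (hη : 0 ≤ η) :
    μ.real {ω | ∃ g, η * (N * J) ≤ ∑ i, ∑ j, ((Y i j ω : ℕ) - f (p.pred i j)) * w g i j} ≤
      Fintype.card G * Real.exp (-(2 * η ^ 2 / B ^ 2 * (N * J))) := by
  have hcast : Measurable fun k : Fin 2 => ((k : ℕ) : ℝ) := Measurable.of_discrete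
  have hsq : ∀ g, ∑ ij : Fin N × Fin J, w g ij.1 ij.2 ^ 2 ≤ B ^ 2 * (N * J) := fun g => by
    refine (Finset.sum_le_card_nsmul _ _ (B ^ 2) fun ij _ => sq_le_sq.2
      ((hw g ij.1 ij.2).trans (le_abs_self B))).trans_eq ?_
    simp [mul_comm]
  have hexponent : 2 * (η * (N * J)) ^ 2 / (B ^ 2 * (N * J)) = 2 * η ^ 2 / B ^ 2 * (N * J) := by
    obtain hNJ | hNJ := eq_or_ne ((N : ℝ) * J) 0
    · simp [hNJ]
    · rw [mul_pow, sq ((N : ℝ) * J), ← mul_assoc, ← mul_assoc, mul_div_mul_right _ _ hNJ,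
        div_mul_eq_mul_div]
  have h := measureReal_exists_sum_sub_integral_mul_ge_le (t := η * (N * J))
    (hY.indep.comp (fun _ k => ((k : ℕ) : ℝ)) fun _ => hcast)
    (fun ij => (hcast.comp (hY.measurable ij.1 ij.2)).aemeasurable)
    (fun ij => Eventually.of_forall fun ω => natCast_fin_two_mem_Icc (Y ij.1 ij.2 ω)) hsq
    (by positivity)
  simp only [Function.comp_def, integral_natCast_fin_two (hY.measurable _ _), hY.prob,
    Fintype.sum_prod_type] at h
  rwa [hexponent] at h

variable {C : ℝ}

lemma exists_measureReal_avgSqDiff_ge_le (K : ℕ)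
    (hf : ContinuousOn f (Set.Icc (-C ^ 2) (C ^ 2)))
    (hf01 : Set.MapsTo f (Set.Icc (-C ^ 2) (C ^ 2)) (Set.Ioo 0 1)) {ε : ℝ} (hε : 0 < ε) :
    ∃ (m n : ℕ) (c : ℝ), 0 < c ∧ ∀ {N J : ℕ} {Ω : Type*} [MeasurableSpace Ω] {μ : Measure Ω}
      {p : Params N J K} {Y : Fin N → Fin J → Ω → Fin 2} {q : Ω → Params N J K},
      IsModel μ f p Y → p ∈ feasible N J K C →
      (∀ᵐ ω ∂μ, q ω ∈ feasible N J K C ∧ Real.log (likelihood f (fun i j => Y i j ω) p) ≤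
        Real.log (likelihood f (fun i j => Y i j ω) (q ω))) →
      μ.real {ω | ε ≤ avgSqDiff f (q ω) p} ≤ m ^ N * n ^ J * Real.exp (-(c * (N * J))) := by
  have hlogit : ContinuousOn (fun x => logit (f x)) (Set.Icc (-C ^ 2) (C ^ 2)) :=
    continuousOn_logit.comp hf hf01
  obtain ⟨B, hB⟩ := isCompact_Icc.exists_bound_of_continuousOn hlogit
  obtain ⟨m, n, hnet⟩ := exists_net_feasible K hlogit (half_pos hε)
  -- `|B| + 1` instead of `B` keeps the rate positive when all log-odds vanish.
  refine ⟨m, n, 2 * (ε / 2) ^ 2 / (2 * (|B| + 1)) ^ 2, by positivity, ?_⟩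
  intro N J Ω _ μ p Y q hY hp hq
  have := hY.indep.isProbabilityMeasure
  obtain ⟨g, hg, hclose⟩ := hnet N J
  have hbound : ∀ {p'}, p' ∈ feasible N J K C → ∀ i j,
      |logit (f (p'.pred i j))| ≤ |B| + 1 := fun hp' i j =>
    (hB _ (pred_mem_Icc hp' i j)).trans (by linarith [le_abs_self B])
  have hsub : {ω | ε ≤ avgSqDiff f (q ω) p} ≤ᵐ[μ] {ω | ∃ k, ε / 2 * (N * J) ≤
      ∑ i, ∑ j, ((Y i j ω : ℕ) - f (p.pred i j)) *
        (logit (f ((g k).pred i j)) - logit (f (p.pred i j)))} := by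
    filter_upwards [hq] with ω ⟨hqω, hlik⟩ hω
    obtain ⟨k, hk⟩ := hclose (q ω) hqω
    have h := le_sum_noise_mul_of_le_avgSqDiff (fun i j => hf01 (pred_mem_Icc hp i j))
      (fun i j => hf01 (pred_mem_Icc hqω i j)) hlik (fun i j => (hk i j).le) hω
    rw [sub_half] at h
    exact ⟨k, h⟩
  refine (ENNReal.toReal_mono (measure_ne_top _ _) (measure_mono_ae hsub)).trans
    ((hY.measureReal_exists_noise_ge_le (B := 2 * (|B| + 1)) (fun k i j => ?_)
      (half_pos hε).le).trans_eq (by simp))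
  linarith [abs_sub (logit (f ((g k).pred i j))) (logit (f (p.pred i j))),
    hbound (hg k) i j, hbound hp i j]

lemma tendsto_pow_mul_pow_mul_exp_neg (a b : ℝ) {c : ℝ} (hc : 0 < c) :
    Tendsto (fun NJ : ℕ × ℕ => a ^ NJ.1 * b ^ NJ.2 * Real.exp (-(c * (NJ.1 * NJ.2))))
      (atTop ×ˢ atTop) (𝓝 0) := by
  have hpow : ∀ (x : ℝ) (k : ℕ), |x| ^ k ≤ Real.exp (|x| * k) := fun x k => by
    rw [mul_comm, Real.exp_nat_mul]
    exact pow_le_pow_left₀ (abs_nonneg x) (by linarith [Real.add_one_le_exp |x|]) k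
  have hfst : Tendsto (fun NJ : ℕ × ℕ => (NJ.1 : ℝ)) (atTop ×ˢ atTop) atTop :=
    tendsto_natCast_atTop_atTop.comp tendsto_fst
  have hsnd : Tendsto (fun NJ : ℕ × ℕ => (NJ.2 : ℝ)) (atTop ×ˢ atTop) atTop :=
    tendsto_natCast_atTop_atTop.comp tendsto_snd
  refine squeeze_zero_norm' ?_ (Real.tendsto_exp_neg_atTop_nhds_zero.comp hfst)
  -- Each half of `c N J` absorbs one of the two powers.
  filter_upwards [hfst.eventually_ge_atTop (2 * |b| / c),
    hsnd.eventually_ge_atTop (2 * (|a| + 1) / c)] with NJ hN hJ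
  rw [div_le_iff₀ hc] at hN hJ
  calc ‖a ^ NJ.1 * b ^ NJ.2 * Real.exp (-(c * (NJ.1 * NJ.2)))‖
      = |a| ^ NJ.1 * |b| ^ NJ.2 * Real.exp (-(c * (NJ.1 * NJ.2))) := by
        rw [Real.norm_eq_abs, abs_mul, abs_mul, abs_pow, abs_pow, Real.abs_exp]
    _ ≤ Real.exp (|a| * NJ.1) * Real.exp (|b| * NJ.2) * Real.exp (-(c * (NJ.1 * NJ.2))) := by
        gcongr <;> exact hpow _ _
    _ ≤ Real.exp (-NJ.1) := by
        rw [← Real.exp_add, ← Real.exp_add, Real.exp_le_exp]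
        linarith [mul_le_mul_of_nonneg_right hN (Nat.cast_nonneg (α := ℝ) NJ.2),
          mul_le_mul_of_nonneg_right hJ (Nat.cast_nonneg (α := ℝ) NJ.1)]

end Consistency

end IFA

theorem corollary1_general {K : ℕ} {C : ℝ} {f : ℝ → ℝ}
    (hf : ContinuousOn f (Set.Icc (-C ^ 2) (C ^ 2)))
    (hf01 : Set.MapsTo f (Set.Icc (-C ^ 2) (C ^ 2)) (Set.Ioo 0 1))
    {Ω : ℕ → ℕ → Type*} [∀ N J, MeasurableSpace (Ω N J)] {μ : ∀ N J, Measure (Ω N J)}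
    {truth : ∀ N J, IFA.Params N J K} {Y : ∀ N J, Fin N → Fin J → Ω N J → Fin 2}
    {est : ∀ N J, Ω N J → IFA.Params N J K}
    (hmodel : ∀ N J, IFA.IsModel (μ N J) f (truth N J) (Y N J))
    (htruth : ∀ N J, truth N J ∈ IFA.feasible N J K C)
    (hest : ∀ N J, ∀ᵐ ω ∂(μ N J), est N J ω ∈ IFA.feasible N J K C ∧
      Real.log (IFA.likelihood f (fun i j => Y N J i j ω) (truth N J)) ≤
        Real.log (IFA.likelihood f (fun i j => Y N J i j ω) (est N J ω)))
    {ε : ℝ} (hε : 0 < ε) :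
    Tendsto
      (fun NJ : ℕ × ℕ =>
        μ NJ.1 NJ.2 {ω | ε ≤ IFA.avgSqDiff f (est NJ.1 NJ.2 ω) (truth NJ.1 NJ.2)})
      (atTop ×ˢ atTop) (𝓝 0) := by
  have := fun N J => (hmodel N J).indep.isProbabilityMeasure
  obtain ⟨m, n, c, hc, hbound⟩ := IFA.exists_measureReal_avgSqDiff_ge_le K hf hf01 hε
  rw [← ENNReal.tendsto_toReal_iff (fun _ => measure_ne_top _ _) ENNReal.zero_ne_top]
  exact squeeze_zero (fun _ => ENNReal.toReal_nonneg)
    (fun NJ => hbound (hmodel NJ.1 NJ.2) (htruth NJ.1 NJ.2) (hest NJ.1 NJ.2))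
    (IFA.tendsto_pow_mul_pow_mul_exp_neg m n hc)

/-- Recovery of response probabilities by the constrained joint maximum likelihood estimator.
For each `N` and `J` the data may live on their own probability space and the true parameters may
depend on `N` and `J`; `N` and `J` grow to infinity jointly, at arbitrary relative rates. -/
theorem corollary1 (K : ℕ) (C : ℝ) (hC : 0 < C) (f : ℝ → ℝ)
    {Ω : ℕ → ℕ → Type*} [∀ N J, MeasurableSpace (Ω N J)]
    (μ : ∀ N J, Measure (Ω N J)) [∀ N J, IsProbabilityMeasure (μ N J)]
    (truth : ∀ N J, IFA.Params N J K)
    (Y : ∀ N J, Fin N → Fin J → Ω N J → Fin 2)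
    (est : ∀ N J, Ω N J → IFA.Params N J K)
    (hmodel : ∀ N J, IFA.IsModel (μ N J) f (truth N J) (Y N J))
    (hest : ∀ N J, ∀ᵐ ω ∂(μ N J), IFA.IsCJMLE f C (fun i j => Y N J i j ω) (est N J ω))
    (A1 : ∀ N J, truth N J ∈ IFA.feasible N J K C)
    (A2 : IFA.RegularLink f C) :
    ∀ ε : ℝ, 0 < ε →
      Tendsto
        (fun NJ : ℕ × ℕ =>
          μ NJ.1 NJ.2 {ω | ε ≤ IFA.avgSqDiff f (est NJ.1 NJ.2 ω) (truth NJ.1 NJ.2)})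
        (atTop ×ˢ atTop) (𝓝 0) :=
  fun _ hε => corollary1_general A2.differentiable.continuous.continuousOn
    (fun x hx => A2.mem_Ioo x (abs_le.2 hx)) hmodel A1
    (fun N J => (hest N J).mono fun _ h => ⟨h.1, h.2 (A1 N J)⟩) hε
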